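/- Let $x_1,\dots,x_n$ take values in $\{0,1\}$. For integers $n,k\ge 0$ and $r\ge 1$ let $\mathrm{DNF}^{k,r}$ denote the class of functions $f:\{0,1\}^n\to\{0,\dots,r\}$ of the form $$f(x)=\max_{t=1,\dots,s} a_t\Big(\bigwedge_{i\in A_t}x_i\Big)\Big(\bigwedge_{j\in B_t}\bar x_j\Big),$$ where $s$ is arbitrary, $a_t\in\{0,\dots,r\}$, $A_t,B_t\subseteq[n]$ and $|A_t|+|B_t|\le k$ for all $t$. Let $f'=\frac{2}{r}f-1$ be the rescaling of $f$ to $[-1,1]$. For $h:\{0,1\}^n\to\mathbb R$ and $S\subseteq[n]$ let $\hat h(S)=\mathbb E_x\big[h(x)\chi_S(x)\big]$ with $\chi_S(x)=\prod_{i\in S}(2x_i-1)$ and $x$ uniform on $\{0,1\}^n$. There is an absolute constant $C>0$ such that for all integers $n,k\ge 0$ and $r\ge 1$, every $f\in\mathrm{DNF}^{k,r}$ and every real $\varepsilon>0$ there is a function $g:\{0,1\}^n\to\mathbb R$ with $$\mathbb E_x\big[(f'(x)-g(x))^2\big]\le\varepsilon$$ that has at most $$\max(k,2)^{\,C\,k\,\log(\max(r,2)/\varepsilon)}$$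 non-zero Fourier coefficients $\hat g(S)$. In particular, for $k,r\ge 2$ the number of non-zero Fourier coefficients of $g$ is at most $k^{C k\log(r/\varepsilon)}=k^{O(k\log(r/\varepsilon))}$. -/

import Mathlib

open scoped BigOperators

/-- A term of a pseudo-Boolean DNF in the variables `x_1, …, x_n`: a constant `a_t ∈ ℕ`, the set
`A_t` of variables that occur positively and the set `B_t` of variables that occur negated. -/
structure PBTerm (n : ℕ) where
  const : ℕ
  pos : Finset (Fin n)
  neg : Finset (Fin n)

namespace PBTerm

/-- The term is satisfied by `x`: all `x_i`, `i ∈ A_t`, are `1` and all `x_j`, `j ∈ B_t`,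
are `0`. -/
def Satisfied {n : ℕ} (t : PBTerm n) (x : Fin n → Bool) : Prop :=
  (∀ i ∈ t.pos, x i = true) ∧ (∀ j ∈ t.neg, x j = false)

instance {n : ℕ} (t : PBTerm n) (x : Fin n → Bool) : Decidable (t.Satisfied x) := by
  unfold Satisfied; infer_instance

/-- The value `a_t (⋀_{i ∈ A_t} x_i) (⋀_{j ∈ B_t} ¬ x_j)` of a term. -/
def eval {n : ℕ} (t : PBTerm n) (x : Fin n → Bool) : ℕ :=
  if t.Satisfied x then t.const else 0

/-- The number of literals `|A_t| + |B_t|`. -/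
def width {n : ℕ} (t : PBTerm n) : ℕ := t.pos.card + t.neg.card

end PBTerm

/-- The class of functions on `{0,1}^n` that have a pseudo-Boolean DNF representation
`f x = max_{t = 1..s} a_t (⋀_{i ∈ A_t} x_i) (⋀_{j ∈ B_t} ¬ x_j)` (of arbitrary size `s`) of width
at most `k` with constants `a_t ∈ {0, …, r}`. The supremum is taken in `ℕ`, so that for `s = 0` it
is the constant `0`. -/
def pbDNF (n k r : ℕ) : Set ((Fin n → Bool) → ℕ) :=
  {f | ∃ (s : ℕ) (T : Fin s → PBTerm n),
    (∀ t, (T t).width ≤ k ∧ (T t).const ≤ r) ∧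
    ∀ x, f x = Finset.univ.sup fun t => (T t).eval x}

/-- The affine rescaling `{0, …, r} → [-1, 1]` of the range of `f`. -/
noncomputable def rescale {n : ℕ} (r : ℕ) (f : (Fin n → Bool) → ℕ) (x : Fin n → Bool) : ℝ :=
  2 / (r : ℝ) * (f x : ℝ) - 1

/-- The coordinate `x'_i = 2 x_i - 1 ∈ {-1, 1}` of a bit `x_i ∈ {0, 1}`. -/
def bitSign (b : Bool) : ℝ := if b then 1 else -1

/-- The Fourier character `χ_S(x) = ∏_{i ∈ S} x'_i` on the cube. -/
def cubeChar {n : ℕ} (S : Finset (Fin n)) (x : Fin n → Bool) : ℝ :=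
  ∏ i ∈ S, bitSign (x i)

/-- The Fourier coefficient `E_x[f(x) χ_S(x)]`, with `x` uniform on the cube. -/
noncomputable def cubeFourierCoeff {n : ℕ} (f : (Fin n → Bool) → ℝ) (S : Finset (Fin n)) : ℝ :=
  𝔼 x, f x * cubeChar S x

/-- `f` has at most `M` non-zero Fourier coefficients. -/
def IsFourierSparse {n : ℕ} (M : ℝ) (f : (Fin n → Bool) → ℝ) : Prop :=
  (Set.ncard {S : Finset (Fin n) | cubeFourierCoeff f S ≠ 0} : ℝ) ≤ M

/-- `g` `ε`-approximates `f`: `E_x[(f(x) - g(x))^2] ≤ ε`, with `x` uniform on the cube. -/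
def Approximates {n : ℕ} (ε : ℝ) (g f : (Fin n → Bool) → ℝ) : Prop :=
  𝔼 x, (f x - g x) ^ 2 ≤ ε

/-! Listing the terms by decreasing constant turns `f'` into a decision list: the first satisfied
term gives the maximum. The list has width `k` and outputs in `[-1, 1]`; its length and `r` play no
further role.

Apply a random restriction leaving each variable free with probability `p = 1/(20k)`. A switching
lemma (`IsDecisionList.eventMean_restrict_le`) shows that the expected "number of leaves" of the
restricted list is at most `2`. Instead of decision trees, the proof uses functionals `L` satisfying
the two inequalities behind leaf counting (`IsLeafBounded`).

Two such functionals are `∑ |ĥ(S)|` and `∑ 2^|S| ĥ(S)²`. Averaged over restrictions they yield `∑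
p^|S| |f̂(S)| ≤ 2` and `∑ (1+p)^|S| f̂(S)² ≤ 2`. The second makes the tail above degree `d ≈ k
log(r/ε)` negligible; the first bounds both the number of large coefficients of degree at most `d`
and the mass of the small ones. Keeping the large ones gives `g` (`exists_sparse_approximation`). -/

/-- The mean of `G` over `ι → α` under the product of the weights `w` on the coordinates. -/
def prodMean {ι α : Type*} [Fintype ι] [DecidableEq ι] [Fintype α] (w : α → ℝ)
    (G : (ι → α) → ℝ) : ℝ :=
  ∑ ρ : ι → α, (∏ i, w (ρ i)) * G ρ

/-! ### Product measures and conditioning on coordinates. -/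

section ProdMean

variable {ι α : Type*} [Fintype ι] [DecidableEq ι] [Fintype α] {w : α → ℝ}

theorem prodMean_prod (g : ι → α → ℝ) :
    prodMean w (fun ρ => ∏ i, g i (ρ i)) = ∏ i, ∑ v, w v * g i v := by
  classical
  rw [Finset.prod_univ_sum, Fintype.piFinset_univ, prodMean]
  simp [Finset.prod_mul_distrib]

theorem prodMean_sum {κ : Type*} (s : Finset κ) (G : κ → (ι → α) → ℝ) :
    prodMean w (fun ρ => ∑ j ∈ s, G j ρ) = ∑ j ∈ s, prodMean w (G j) := by
  simp only [prodMean, Finset.mul_sum]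
  exact Finset.sum_comm

theorem prodMean_const_mul (c : ℝ) (G : (ι → α) → ℝ) :
    prodMean w (fun ρ => c * G ρ) = c * prodMean w G := by
  simp only [prodMean, Finset.mul_sum]
  exact Finset.sum_congr rfl fun _ _ => by ring

theorem prodMean_add (G H : (ι → α) → ℝ) :
    prodMean w (fun ρ => G ρ + H ρ) = prodMean w G + prodMean w H := by
  simp only [prodMean, mul_add, Finset.sum_add_distrib]

theorem prodMean_mono (hw : ∀ v, 0 ≤ w v) {G H : (ι → α) → ℝ} (h : ∀ ρ, G ρ ≤ H ρ) :
    prodMean w G ≤ prodMean w H :=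
  Finset.sum_le_sum fun ρ _ =>
    mul_le_mul_of_nonneg_left (h ρ) (Finset.prod_nonneg fun _ _ => hw _)

theorem prodMean_nonneg (hw : ∀ v, 0 ≤ w v) {G : (ι → α) → ℝ} (h : ∀ ρ, 0 ≤ G ρ) :
    0 ≤ prodMean w G :=
  Finset.sum_nonneg fun ρ _ => mul_nonneg (Finset.prod_nonneg fun _ _ => hw _) (h ρ)

theorem prodMean_one (hw : ∑ v, w v = 1) : prodMean (ι := ι) w (fun _ => 1) = 1 := by
  simpa [hw] using prodMean_prod (ι := ι) (w := w) (fun _ _ => 1)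

theorem abs_prodMean_le (hw : ∀ v, 0 ≤ w v) (G : (ι → α) → ℝ) :
    |prodMean w G| ≤ prodMean w (fun ρ => |G ρ|) := by
  refine (Finset.abs_sum_le_sum_abs _ _).trans (Finset.sum_le_sum fun ρ _ => ?_)
  rw [abs_mul, abs_of_nonneg (Finset.prod_nonneg fun _ _ => hw _)]

/-- Independence: conditioning on one coordinate amounts to overwriting it, at the price of its
weight. -/
theorem prodMean_ite_coord [DecidableEq α] (hw : ∑ v, w v = 1) (i : ι) (v : α)
    (G : (ι → α) → ℝ) :
    prodMean w (fun ρ => if ρ i = v then G ρ else 0)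
      = w v * prodMean w (fun ρ => G (Function.update ρ i v)) := by
  have key : ∀ H : (ι → α) → ℝ, prodMean w H = ∑ y : {j // j ≠ i} → α,
      (∏ j, w (y j)) * ∑ u, w u * H ((Equiv.funSplitAt i α).symm (u, y)) := by
    intro H
    rw [prodMean, ← (Equiv.funSplitAt i α).symm.sum_comp, Fintype.sum_prod_type,
      Finset.sum_comm]
    refine Finset.sum_congr rfl fun y _ => ?_
    rw [Finset.mul_sum]
    refine Finset.sum_congr rfl fun u _ => ?_
    rw [Fintype.prod_eq_mul_prod_subtype_ne _ i]
    have : ∀ j : {j // j ≠ i}, (Equiv.funSplitAt i α).symm (u, y) j = y j := by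
      intro j; simp [Equiv.funSplitAt, Equiv.piSplitAt, j.2]
    simp only [this]
    simp [Equiv.funSplitAt, Equiv.piSplitAt]
    ring
  rw [key, key, Finset.mul_sum]
  refine Finset.sum_congr rfl fun y _ => ?_
  have hu : ∀ u, Function.update ((Equiv.funSplitAt i α).symm (u, y)) i v
      = (Equiv.funSplitAt i α).symm (v, y) := by
    intro u; ext j
    by_cases hj : j = i
    · subst hj; simp [Equiv.funSplitAt, Equiv.piSplitAt]
    · simp [Equiv.funSplitAt, Equiv.piSplitAt, hj]
  have hi : ∀ u, (Equiv.funSplitAt i α).symm (u, y) i = u := by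
    intro u; simp [Equiv.funSplitAt, Equiv.piSplitAt]
  simp only [hu, hi, ← Finset.sum_mul, hw, mul_ite, mul_zero, Finset.sum_ite_eq',
    Finset.mem_univ, if_true]
  ring

theorem prodMean_ite_forall [DecidableEq α] (hw : ∑ v, w v = 1) (W : Finset ι) (q : ι → α)
    (G : (ι → α) → ℝ) :
    prodMean w (fun ρ => if ∀ i ∈ W, ρ i = q i then G ρ else 0)
      = (∏ i ∈ W, w (q i)) * prodMean w (fun ρ => G (W.piecewise q ρ)) := by
  induction W using Finset.induction_on generalizing G with
  | empty => simp
  | insert i W hi ih =>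
    have h1 : ∀ ρ : ι → α, (if ∀ j ∈ insert i W, ρ j = q j then G ρ else 0)
        = if ∀ j ∈ W, ρ j = q j then (if ρ i = q i then G ρ else 0) else 0 := by
      intro ρ
      by_cases h : ρ i = q i <;> simp [h]
    simp only [h1]
    rw [ih, Finset.prod_insert hi]
    simp only [Finset.piecewise_eq_of_notMem _ _ _ hi]
    rw [prodMean_ite_coord hw i (q i) (fun ρ => G (W.piecewise q ρ))]
    have h2 : ∀ ρ : ι → α, W.piecewise q (Function.update ρ i (q i))
        = (insert i W).piecewise q ρ := by
      intro ρ; ext j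
      by_cases hj : j = i
      · subst hj; simp [hi]
      · by_cases hW : j ∈ W <;> simp [hj, hW]
    simp only [h2]
    ring

end ProdMean

/-! ### Fourier analysis on the cube. -/

section Fourier

variable {n : ℕ}

theorem expect_eq_prodMean (G : (Fin n → Bool) → ℝ) :
    (𝔼 x, G x) = prodMean (fun _ => 1 / 2) G := by
  rw [Fintype.expect_eq_sum_div_card, prodMean, ← Finset.mul_sum]
  simp
  ring

theorem sum_prod_ite_mem {ι : Type*} [Fintype ι] [DecidableEq ι] (f g : ι → ℝ) :
    ∑ S : Finset ι, ∏ i, (if i ∈ S then f i else g i) = ∏ i, (f i + g i) := by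
  rw [Fintype.prod_add]
  refine Finset.sum_congr rfl fun S _ => ?_
  rw [Finset.prod_ite]
  congr 2
  · ext; simp
  · ext; simp

theorem cubeChar_eq_prod_ite (S : Finset (Fin n)) (x : Fin n → Bool) :
    cubeChar S x = ∏ i, (if i ∈ S then bitSign (x i) else 1) := by
  simp [cubeChar, Finset.prod_ite_mem]

theorem bitSign_mul_self (b : Bool) : bitSign b * bitSign b = 1 := by
  cases b <;> simp [bitSign]

theorem sum_cubeChar_mul (x y : Fin n → Bool) :
    ∑ S, cubeChar S x * cubeChar S y = if x = y then 2 ^ n else 0 := by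
  have : ∀ S : Finset (Fin n), cubeChar S x * cubeChar S y
      = ∏ i, (if i ∈ S then bitSign (x i) * bitSign (y i) else 1) := by
    intro S
    rw [cubeChar_eq_prod_ite, cubeChar_eq_prod_ite, ← Finset.prod_mul_distrib]
    exact Finset.prod_congr rfl fun i _ => by split_ifs <;> simp
  simp only [this]
  rw [sum_prod_ite_mem]
  split_ifs with h
  · subst h
    simp [bitSign_mul_self]
    norm_num
  · obtain ⟨i, hi⟩ := Function.ne_iff.1 h
    refine Finset.prod_eq_zero (Finset.mem_univ i) ?_
    revert hi
    cases x i <;> cases y i <;> simp [bitSign]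

theorem eq_sum_cubeFourierCoeff (f : (Fin n → Bool) → ℝ) (x : Fin n → Bool) :
    f x = ∑ S, cubeFourierCoeff f S * cubeChar S x := by
  simp only [cubeFourierCoeff, Fintype.expect_eq_sum_div_card, div_mul_eq_mul_div,
    Finset.sum_mul, Finset.sum_div]
  rw [Finset.sum_comm]
  have : ∀ y, ∑ S, f y * cubeChar S y * cubeChar S x / (Fintype.card (Fin n → Bool) : ℝ)
      = if y = x then f x else 0 := by
    intro y
    simp only [mul_assoc, ← Finset.sum_div, ← Finset.mul_sum, sum_cubeChar_mul]
    by_cases h : y = x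
    · simp [h]
    · simp [h]
  simp only [this]
  simp

theorem expect_cubeChar_mul (S T : Finset (Fin n)) :
    𝔼 x, cubeChar S x * cubeChar T x = if S = T then 1 else 0 := by
  have : ∀ x : Fin n → Bool, cubeChar S x * cubeChar T x
      = ∏ i, ((if i ∈ S then bitSign (x i) else 1) * (if i ∈ T then bitSign (x i) else 1)) := by
    intro x
    rw [cubeChar_eq_prod_ite, cubeChar_eq_prod_ite, ← Finset.prod_mul_distrib]
  simp only [this]
  rw [expect_eq_prodMean, prodMean_prod (fun i b =>
    (if i ∈ S then bitSign b else 1) * (if i ∈ T then bitSign b else 1))]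
  split_ifs with h
  · subst h
    refine Finset.prod_eq_one fun i _ => ?_
    by_cases hi : i ∈ S <;> simp [hi, bitSign]
    norm_num
  · obtain ⟨i, hi⟩ : ∃ i, ¬(i ∈ S ↔ i ∈ T) := by
      by_contra! hc; exact h (Finset.ext hc)
    refine Finset.prod_eq_zero (Finset.mem_univ i) ?_
    by_cases h1 : i ∈ S <;> by_cases h2 : i ∈ T <;> simp_all [bitSign]

theorem cubeFourierCoeff_sum {κ : Type*} (s : Finset κ) (f : κ → (Fin n → Bool) → ℝ)
    (S : Finset (Fin n)) :
    cubeFourierCoeff (fun x => ∑ j ∈ s, f j x) S = ∑ j ∈ s, cubeFourierCoeff (f j) S := by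
  simp only [cubeFourierCoeff, Finset.sum_mul]
  exact Finset.expect_sum_comm _ _ _

theorem cubeFourierCoeff_const_mul (c : ℝ) (f : (Fin n → Bool) → ℝ) (S : Finset (Fin n)) :
    cubeFourierCoeff (fun x => c * f x) S = c * cubeFourierCoeff f S := by
  simp only [cubeFourierCoeff, mul_assoc, Finset.mul_expect]

theorem cubeFourierCoeff_sum_cubeChar (A : Finset (Finset (Fin n))) (c : Finset (Fin n) → ℝ)
    (S : Finset (Fin n)) :
    cubeFourierCoeff (fun x => ∑ T ∈ A, c T * cubeChar T x) S = if S ∈ A then c S else 0 := by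
  rw [cubeFourierCoeff_sum]
  simp only [cubeFourierCoeff_const_mul]
  simp [cubeFourierCoeff, expect_cubeChar_mul]

/-- Parseval's identity. -/
theorem expect_sq_eq_sum_cubeFourierCoeff_sq (f : (Fin n → Bool) → ℝ) :
    𝔼 x, f x ^ 2 = ∑ S, cubeFourierCoeff f S ^ 2 := by
  have : ∀ x, f x ^ 2 = ∑ S, cubeFourierCoeff f S * (f x * cubeChar S x) := by
    intro x
    conv_lhs => rw [sq]; enter [2]; rw [eq_sum_cubeFourierCoeff f x]
    rw [Finset.mul_sum]
    exact Finset.sum_congr rfl fun _ _ => by ring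
  simp only [this]
  rw [Finset.expect_sum_comm]
  refine Finset.sum_congr rfl fun S _ => ?_
  rw [← Finset.mul_expect, sq, cubeFourierCoeff]

/-- The Fourier coefficients of the restriction of `h` to the facet `x_i = b`. -/
theorem cubeFourierCoeff_update (h : (Fin n → Bool) → ℝ) {i : Fin n} (b : Bool)
    {S : Finset (Fin n)} (hi : i ∉ S) :
    cubeFourierCoeff (fun x => h (Function.update x i b)) S
      = cubeFourierCoeff h S + bitSign b * cubeFourierCoeff h (insert i S) := by
  have h1 := prodMean_ite_coord (w := fun _ : Bool => (1 / 2 : ℝ)) (by norm_num) i b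
    (fun x => h x * cubeChar S x)
  have h2 : ∀ x : Fin n → Bool, cubeChar S (Function.update x i b) = cubeChar S x := by
    intro x
    refine Finset.prod_congr rfl fun j hj => ?_
    rw [Function.update_of_ne (by rintro rfl; exact hi hj)]
  simp only [h2] at h1
  have h3 : ∀ x : Fin n → Bool, h x * cubeChar S x + bitSign b * (h x * cubeChar (insert i S) x)
      = 2 * (if x i = b then h x * cubeChar S x else 0) := by
    intro x
    rw [cubeChar, cubeChar, Finset.prod_insert hi]
    cases b <;> cases x i <;> simp [bitSign] <;> ring
  simp only [cubeFourierCoeff, expect_eq_prodMean]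
  rw [← prodMean_const_mul, ← prodMean_add]
  simp only [h3]
  rw [prodMean_const_mul, h1]
  ring

end Fourier

/-! ### Random restrictions and the switching lemma. -/

/-- Substitute the values fixed by the partial assignment `σ` into the point `x`. -/
def overwrite {n : ℕ} (σ : Fin n → Option Bool) (x : Fin n → Bool) : Fin n → Bool :=
  fun i => (σ i).getD (x i)

/-- The distribution of a coordinate of a random restriction: free with probability `p`, and fixed
to either bit with probability `(1 - p) / 2`. -/
noncomputable def starWeight (p : ℝ) : Option Bool → ℝ
  | none => p
  | some _ => (1 - p) / 2

theorem sum_starWeight (p : ℝ) : ∑ v, starWeight p v = 1 := by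
  simp [Fintype.sum_option, starWeight]
  ring

theorem starWeight_nonneg {p : ℝ} (h0 : 0 ≤ p) (h1 : p ≤ 1) (v : Option Bool) :
    0 ≤ starWeight p v := by
  cases v <;> simp [starWeight] <;> linarith

/-- Decision lists on the cube whose tests are conjunctions of at most `k` literals and whose
outputs lie in `[-1, 1]`. A test is given by its variables `V` and the required values `s`. -/
inductive IsDecisionList {n : ℕ} (k : ℕ) : ((Fin n → Bool) → ℝ) → Prop
  | const (c : ℝ) (hc : |c| ≤ 1) : IsDecisionList k (fun _ => c)
  | ite (V : Finset (Fin n)) (s : Fin n → Bool) (c : ℝ) (f : (Fin n → Bool) → ℝ)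
      (hV : V.card ≤ k) (hc : |c| ≤ 1) (hf : IsDecisionList k f) :
      IsDecisionList k (fun x => if ∀ i ∈ V, x i = s i then c else f x)

/-- A functional that is at most `1` on constants from `[-1, 1]` and is subadditive under
branching on a variable; it is bounded by the number of leaves of any decision tree with outputs
in `[-1, 1]`. -/
structure IsLeafBounded {n : ℕ} (L : ((Fin n → Bool) → ℝ) → ℝ) : Prop where
  const_le : ∀ c : ℝ, |c| ≤ 1 → L (fun _ => c) ≤ 1
  branch_le : ∀ (h : (Fin n → Bool) → ℝ) (i : Fin n),
    L h ≤ L (fun x => h (Function.update x i false)) + L (fun x => h (Function.update x i true))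

/-- Events on partial assignments that are preserved by fixing more variables. -/
def IsFixingClosed {n : ℕ} (D : (Fin n → Option Bool) → Prop) : Prop :=
  ∀ ρ ρ', (∀ i, ρ i = none ∨ ρ' i = ρ i) → D ρ → D ρ'

section Restriction

variable {n k : ℕ}

/-- Query every variable of `Y`; `Z` is the set of those answered `true`. -/
theorem IsLeafBounded.le_sum_powerset {L : ((Fin n → Bool) → ℝ) → ℝ} (hL : IsLeafBounded L)
    (Y : Finset (Fin n)) (h : (Fin n → Bool) → ℝ) :
    L h ≤ ∑ Z ∈ Y.powerset, L (fun x => h (Y.piecewise (fun i => decide (i ∈ Z)) x)) := by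
  induction Y using Finset.induction_on with
  | empty => simp
  | insert i Y hi ih =>
    rw [Finset.sum_powerset_insert hi, ← Finset.sum_add_distrib]
    refine ih.trans (Finset.sum_le_sum fun Z hZ => (hL.branch_le _ i).trans (le_of_eq ?_))
    have hiZ : i ∉ Z := fun h' => hi (Finset.mem_powerset.1 hZ h')
    congr 2
    · funext x; congr 1; ext j
      by_cases hj : j = i
      · subst hj; simp [hi, hiZ]
      · by_cases hY : j ∈ Y <;> simp [hj, hY]
    · funext x; congr 1; ext j
      by_cases hj : j = i
      · subst hj; simp [hi]
      · by_cases hY : j ∈ Y <;> simp [hj, hY]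

/-- The pattern of a restriction that leaves `Y` free and agrees with `s` elsewhere. -/
def freePattern (s : Fin n → Bool) (Y : Finset (Fin n)) (i : Fin n) : Option Bool :=
  if i ∈ Y then none else some (s i)

theorem prod_starWeight_freePattern (p : ℝ) (s : Fin n → Bool) {W Y : Finset (Fin n)}
    (hY : Y ⊆ W) :
    ∏ i ∈ W, starWeight p (freePattern s Y i)
      = p ^ Y.card * ((1 - p) / 2) ^ (W.card - Y.card) := by
  have : ∀ i, starWeight p (freePattern s Y i) = if i ∈ Y then p else (1 - p) / 2 := by
    intro i; unfold freePattern; split_ifs <;> simp [starWeight]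
  simp only [this]
  rw [Finset.prod_ite, Finset.prod_const, Finset.prod_const, Finset.filter_mem_eq_inter,
    Finset.inter_eq_right.2 hY, Finset.filter_notMem_eq_sdiff, Finset.card_sdiff_of_subset hY]

open Classical in
/-- The mean of `G` over the restrictions in the event `D`. -/
noncomputable def eventMean (p : ℝ) (D : (Fin n → Option Bool) → Prop)
    (G : (Fin n → Option Bool) → ℝ) : ℝ :=
  prodMean (starWeight p) (fun ρ => if D ρ then G ρ else 0)

theorem eventMean_mono {p : ℝ} (h0 : 0 ≤ p) (h1 : p ≤ 1) {D : (Fin n → Option Bool) → Prop}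
    {G H : (Fin n → Option Bool) → ℝ} (h : ∀ ρ, D ρ → G ρ ≤ H ρ) :
    eventMean p D G ≤ eventMean p D H :=
  prodMean_mono (starWeight_nonneg h0 h1) fun ρ => by
    split_ifs with hρ
    exacts [h ρ hρ, le_rfl]

theorem eventMean_one_nonneg {p : ℝ} (h0 : 0 ≤ p) (h1 : p ≤ 1)
    (D : (Fin n → Option Bool) → Prop) : 0 ≤ eventMean p D (fun _ => 1) :=
  prodMean_nonneg (starWeight_nonneg h0 h1) fun ρ => by split_ifs <;> norm_num

theorem eventMean_one_mono {p : ℝ} (h0 : 0 ≤ p) (h1 : p ≤ 1)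
    {D E : (Fin n → Option Bool) → Prop} (h : ∀ ρ, D ρ → E ρ) :
    eventMean p D (fun _ => 1) ≤ eventMean p E (fun _ => 1) :=
  prodMean_mono (starWeight_nonneg h0 h1) fun ρ => by
    by_cases hD : D ρ
    · simp [hD, h ρ hD]
    · by_cases hE : E ρ <;> simp [hD, hE]

theorem eventMean_sum {κ : Type*} (p : ℝ) (D : (Fin n → Option Bool) → Prop) (s : Finset κ)
    (G : κ → (Fin n → Option Bool) → ℝ) :
    eventMean p D (fun ρ => ∑ j ∈ s, G j ρ) = ∑ j ∈ s, eventMean p D (G j) := by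
  unfold eventMean
  rw [← prodMean_sum]
  congr 1
  funext ρ
  split_ifs <;> simp

/-- Splitting the mean over restrictions according to whether a conjunction is falsified and, if
not, which of its variables are left free. -/
theorem eventMean_split (p : ℝ) (W : Finset (Fin n)) (s : Fin n → Bool)
    (D : (Fin n → Option Bool) → Prop) (G : (Fin n → Option Bool) → ℝ) :
    eventMean p D G
      = eventMean p (fun ρ => D ρ ∧ ∃ i ∈ W, ρ i = some (!s i)) G
        + ∑ Y ∈ W.powerset, p ^ Y.card * ((1 - p) / 2) ^ (W.card - Y.card) *
          eventMean p (fun ρ => D (W.piecewise (freePattern s Y) ρ))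
            (fun ρ => G (W.piecewise (freePattern s Y) ρ)) := by
  classical
  have h1 : ∀ Y ∈ W.powerset, p ^ Y.card * ((1 - p) / 2) ^ (W.card - Y.card) *
        eventMean p (fun ρ => D (W.piecewise (freePattern s Y) ρ))
            (fun ρ => G (W.piecewise (freePattern s Y) ρ))
      = prodMean (starWeight p) (fun ρ => if ∀ i ∈ W, ρ i = freePattern s Y i then
          (if D ρ then G ρ else 0) else 0) := by
    intro Y hY
    rw [← prod_starWeight_freePattern p s (Finset.mem_powerset.1 hY)]
    have := prodMean_ite_forall (sum_starWeight p) W (freePattern s Y)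
      (fun ρ => if D ρ then G ρ else 0)
    rw [eventMean]
    convert this.symm
  rw [Finset.sum_congr rfl h1, ← prodMean_sum]
  unfold eventMean
  rw [← prodMean_add]
  congr 1
  funext ρ
  by_cases hf : ∃ i ∈ W, ρ i = some (!s i)
  · rw [Finset.sum_eq_zero, add_zero]
    · by_cases hD : D ρ <;> simp [hf, hD]
    · intro Y _
      obtain ⟨i, hi, hs⟩ := hf
      refine if_neg fun h => ?_
      have := h i hi
      rw [hs, freePattern] at this
      split_ifs at this
      simp at this
  -- If the conjunction is not falsified, exactly one `Y` matches `ρ`: the set of variables of `W`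
  -- that it leaves free.
  · rw [if_neg (c := D ρ ∧ _) (fun h => hf h.2), zero_add,
      Finset.sum_eq_single_of_mem (W.filter fun i => ρ i = none) (by simp)]
    · refine Eq.symm (if_pos ?_)
      intro i hi
      push Not at hf
      have := hf i hi
      unfold freePattern
      rcases hρ : ρ i with _ | b
      · simp [hi, hρ]
      · rw [hρ] at this
        simp only [Finset.mem_filter, hρ]
        revert this
        cases b <;> cases s i <;> simp
    · intro Y hY hne
      refine if_neg fun h => hne ?_
      ext i
      simp only [Finset.mem_filter]
      constructor
      · intro hi
        have hW := Finset.mem_powerset.1 hY hi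
        exact ⟨hW, by rw [h i hW, freePattern, if_pos hi]⟩
      · rintro ⟨hW, hn⟩
        rw [h i hW, freePattern] at hn
        by_contra hi
        simp [hi] at hn

/-- A switching lemma for decision lists: the expected number of leaves after a random
restriction, conditioned on any event preserved by fixing more variables, is at most `2`. -/
theorem IsDecisionList.eventMean_restrict_le {p : ℝ} (h0 : 0 ≤ p) (h1 : p ≤ 1)
    (hk : ∀ w ≤ k, 2 * (2 * p + (1 - p) / 2) ^ w ≤ 3 * ((1 - p) / 2) ^ w)
    {L : ((Fin n → Bool) → ℝ) → ℝ} (hL : IsLeafBounded L)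
    {f : (Fin n → Bool) → ℝ} (hf : IsDecisionList k f) (τ : Fin n → Option Bool)
    {D : (Fin n → Option Bool) → Prop} (hD : IsFixingClosed D) :
    eventMean p D (fun ρ => L (fun x => f (overwrite τ (overwrite ρ x))))
      ≤ 2 * eventMean p D (fun _ => 1) := by
  have hconst : ∀ (E : (Fin n → Option Bool) → Prop) (G : (Fin n → Option Bool) → ℝ),
      (∀ ρ, G ρ ≤ 1) → eventMean p E G ≤ eventMean p E (fun _ => 1) := fun E G hG =>
    eventMean_mono h0 h1 fun ρ _ => hG ρ
  -- The tail of the list is met with more variables answered (recorded in `τ`) and with `ρ`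
  -- conditioned on earlier tests (recorded in `D`), so both must vary.
  induction hf generalizing τ D with
  | const c hc =>
    have := hconst D _ fun _ => hL.const_le c hc
    linarith [eventMean_one_nonneg h0 h1 D]
  | ite V s c f hV hc hf ih =>
    -- A test already falsified by `τ` can be skipped; otherwise only its variables outside `τ`
    -- matter.
    by_cases hτ : ∀ i ∈ V, τ i = none ∨ τ i = some (s i)
    swap
    · push Not at hτ
      obtain ⟨i, hi, hi1, hi2⟩ := hτ
      have : ∀ y, ¬ ∀ j ∈ V, overwrite τ y j = s j := by
        intro y hy
        have := hy i hi
        unfold overwrite at this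
        rcases h : τ i with _ | b
        · exact hi1 h
        · rw [h] at this hi2
          exact hi2 (by simpa using this)
      simp only [this, if_false]
      exact ih τ hD
    set W := V.filter fun i => τ i = none with hWdef
    have hWk : W.card ≤ k := (Finset.card_filter_le _ _).trans hV
    have hsat : ∀ y, (∀ i ∈ V, overwrite τ y i = s i) ↔ ∀ i ∈ W, y i = s i := by
      intro y
      constructor
      · intro h i hi
        rw [hWdef, Finset.mem_filter] at hi
        simpa [overwrite, hi.2] using h i hi.1
      · intro h i hi
        rcases hτ i hi with hn | hs
        · simpa [overwrite, hn] using h i (by simp [hWdef, hi, hn])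
        · simp [overwrite, hs]
    simp only [hsat]
    set a := (1 - p) / 2 with ha
    have ha0 : 0 ≤ a := by rw [ha]; linarith
    rw [eventMean_split p W s D, eventMean_split p W s D (fun _ => 1)]
    set E : Finset (Fin n) → (Fin n → Option Bool) → Prop :=
      fun Y ρ => D (W.piecewise (freePattern s Y) ρ) with hE
    set S0 := eventMean p (E ∅) (fun _ => 1) with hS0
    have hS0n : 0 ≤ S0 := eventMean_one_nonneg h0 h1 _
    -- Being falsified survives fixing more variables, so the induction hypothesis applies to this
    -- event directly.
    have hfals : eventMean p (fun ρ => D ρ ∧ ∃ i ∈ W, ρ i = some (!s i)) (fun ρ =>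
          L (fun x => if ∀ i ∈ W, overwrite ρ x i = s i then c
            else f (overwrite τ (overwrite ρ x))))
        ≤ 2 * eventMean p (fun ρ => D ρ ∧ ∃ i ∈ W, ρ i = some (!s i)) (fun _ => 1) := by
      refine (eventMean_mono h0 h1 ?_).trans (ih τ ?_)
      · rintro ρ ⟨-, i, hi, hs⟩
        refine le_of_eq (congrArg L ?_)
        funext x
        refine if_neg fun h => ?_
        have := h i hi
        simp [overwrite, hs] at this
      · rintro ρ ρ' hρ ⟨h, i, hi, hs⟩
        refine ⟨hD ρ ρ' hρ h, i, hi, ?_⟩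
        rcases hρ i with h' | h'
        · rw [h'] at hs; cases hs
        · rw [h', hs]
    have hEclosed : ∀ Y, IsFixingClosed (E Y) := by
      intro Y ρ ρ' hρ h
      refine hD _ _ (fun i => ?_) h
      by_cases hi : i ∈ W
      · right; simp [hi]
      · simpa [hi] using hρ i
    -- Replacing the free variables of `Y` by their values in `s` only fixes more, so `E Y` implies
    -- `E ∅`.
    have hE0 : ∀ Y, eventMean p (E Y) (fun _ => 1) ≤ S0 := by
      intro Y
      refine eventMean_one_mono h0 h1 fun ρ => hD _ _ fun i => ?_
      by_cases hi : i ∈ W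
      · by_cases hY : i ∈ Y <;> simp [hi, hY, freePattern]
      · simp [hi]
    have hbranch : ∀ Y ∈ W.powerset, eventMean p (E Y) (fun ρ =>
          L (fun x => if ∀ i ∈ W, overwrite (W.piecewise (freePattern s Y) ρ) x i = s i then c
            else f (overwrite τ (overwrite (W.piecewise (freePattern s Y) ρ) x))))
        ≤ 2 ^ Y.card * (2 * S0) := by
      intro Y hY
      have hYW := Finset.mem_powerset.1 hY
      have hstep : ∀ ρ,
          L (fun x => if ∀ i ∈ W, overwrite (W.piecewise (freePattern s Y) ρ) x i = s i then c
            else f (overwrite τ (overwrite (W.piecewise (freePattern s Y) ρ) x)))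
          ≤ ∑ Z ∈ Y.powerset,
            L (fun x => if ∀ i ∈ W, (if i ∈ Y then decide (i ∈ Z) else s i) = s i then c
              else f (overwrite
                (W.piecewise (fun i => some (if i ∈ Y then decide (i ∈ Z) else s i)) τ)
                (overwrite ρ x))) := by
        intro ρ
        refine (hL.le_sum_powerset Y _).trans (le_of_eq (Finset.sum_congr rfl fun Z _ => ?_))
        congr 1
        funext x
        have hv : ∀ i ∈ W, overwrite (W.piecewise (freePattern s Y) ρ)
            (Y.piecewise (fun i => decide (i ∈ Z)) x) i
              = if i ∈ Y then decide (i ∈ Z) else s i := by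
          intro i hi
          by_cases hiY : i ∈ Y <;> simp [overwrite, hi, hiY, freePattern]
        have hc' : (∀ i ∈ W, overwrite (W.piecewise (freePattern s Y) ρ)
            (Y.piecewise (fun i => decide (i ∈ Z)) x) i = s i)
              ↔ ∀ i ∈ W, (if i ∈ Y then decide (i ∈ Z) else s i) = s i :=
          forall₂_congr fun i hi => by rw [hv i hi]
        simp only [hc']
        congr 2
        ext i
        by_cases hi : i ∈ W
        · have hτi : τ i = none := (Finset.mem_filter.1 hi).2
          have := hv i hi
          simp only [overwrite, hτi, Option.getD_none] at this ⊢
          rw [this]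
          simp [hi]
        · have hiY : i ∉ Y := fun h => hi (hYW h)
          simp [overwrite, hi, hiY]
      refine (eventMean_mono h0 h1 fun ρ _ => hstep ρ).trans ?_
      rw [eventMean_sum]
      refine (Finset.sum_le_card_nsmul _ _ (2 * S0) fun Z _ => ?_).trans (by simp)
      by_cases hs : ∀ i ∈ W, (if i ∈ Y then decide (i ∈ Z) else s i) = s i
      · have := hconst (E Y) _ fun _ => hL.const_le c hc
        refine (eventMean_mono h0 h1 (H := fun _ => L fun _ => c) fun ρ _ =>
          le_of_eq (congrArg L (funext fun x => if_pos hs))).trans ?_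
        linarith [hE0 Y]
      · refine (eventMean_mono h0 h1 fun ρ _ =>
          le_of_eq (congrArg L (funext fun x => if_neg hs))).trans ?_
        exact (ih _ (hEclosed Y)).trans (by linarith [hE0 Y])
    -- With no variable free the test is satisfied and the output is constant: one leaf instead of
    -- the bound `2`. This saving pays for all nonempty `Y`.
    have hempty : eventMean p (E ∅) (fun ρ =>
          L (fun x => if ∀ i ∈ W, overwrite (W.piecewise (freePattern s ∅) ρ) x i = s i then c
            else f (overwrite τ (overwrite (W.piecewise (freePattern s ∅) ρ) x)))) ≤ S0 := by
      refine hconst _ _ fun ρ => ?_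
      have : ∀ x, ∀ i ∈ W, overwrite (W.piecewise (freePattern s ∅) ρ) x i = s i := by
        intro x i hi
        simp [overwrite, hi, freePattern]
      exact (le_of_eq (congrArg L (funext fun x => if_pos (this x)))).trans (hL.const_le c hc)
    have hsum : ∑ Y ∈ W.powerset, p ^ Y.card * a ^ (W.card - Y.card) * eventMean p (E Y) (fun ρ =>
          L (fun x => if ∀ i ∈ W, overwrite (W.piecewise (freePattern s Y) ρ) x i = s i then c
            else f (overwrite τ (overwrite (W.piecewise (freePattern s Y) ρ) x))))
        ≤ ∑ Y ∈ W.powerset, ((2 * p) ^ Y.card * a ^ (W.card - Y.card) * (2 * S0)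
            - if Y = ∅ then a ^ W.card * S0 else 0) := by
      refine Finset.sum_le_sum fun Y hY => ?_
      by_cases hY0 : Y = ∅
      · subst hY0
        have := mul_le_mul_of_nonneg_left hempty (pow_nonneg ha0 W.card)
        simp only [Finset.card_empty, pow_zero, one_mul, Nat.sub_zero, if_true]
        linarith
      · rw [if_neg hY0, sub_zero, mul_pow]
        have := mul_le_mul_of_nonneg_left (hbranch Y hY)
          (mul_nonneg (pow_nonneg h0 Y.card) (pow_nonneg ha0 (W.card - Y.card)))
        linarith
    rw [Finset.sum_sub_distrib, ← Finset.sum_mul, Finset.sum_pow_mul_eq_add_pow,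
      Finset.sum_ite_eq' _ _ _, if_pos (Finset.empty_mem_powerset W)] at hsum
    -- The unfalsified part costs at most `(2 (2p + a)^w - a^w) S0` with `w = |W|`, while twice its
    -- probability is at least `2 a^w S0`. The hypothesis `hk` is exactly the comparison of the two.
    have hlow : a ^ W.card * S0
        ≤ ∑ Y ∈ W.powerset, p ^ Y.card * a ^ (W.card - Y.card) * eventMean p (E Y) (fun _ => 1) := by
      have := Finset.single_le_sum (f := fun Y : Finset (Fin n) =>
        p ^ Y.card * a ^ (W.card - Y.card) * eventMean p (E Y) (fun _ => 1))
        (fun Y _ => mul_nonneg (mul_nonneg (pow_nonneg h0 _) (pow_nonneg ha0 _))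
          (eventMean_one_nonneg h0 h1 _)) (Finset.empty_mem_powerset W)
      simpa using this
    have := mul_le_mul_of_nonneg_right (hk W.card hWk) hS0n
    linarith

end Restriction

/-! ### Two leaf-bounded Fourier functionals and their averages. -/

section FourierFunctionals

variable {n k : ℕ}

theorem cubeFourierCoeff_const (c : ℝ) (S : Finset (Fin n)) :
    cubeFourierCoeff (fun _ => c) S = if S = ∅ then c else 0 := by
  simpa [cubeChar] using cubeFourierCoeff_sum_cubeChar {∅} (fun _ => c) S

theorem sum_eq_sum_powerset_erase (i : Fin n) (φ : Finset (Fin n) → ℝ) :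
    ∑ S, φ S = ∑ S ∈ (Finset.univ.erase i).powerset, (φ S + φ (insert i S)) := by
  rw [Finset.sum_add_distrib, ← Finset.sum_powerset_insert (Finset.notMem_erase i _),
    Finset.insert_erase (Finset.mem_univ i), Finset.powerset_univ]

/-- Pairing `S` with `insert i S`, this is `|a| + |b| ≤ |a - b| + |a + b|`. -/
theorem isLeafBounded_sum_abs :
    IsLeafBounded (n := n) (fun h => ∑ S, |cubeFourierCoeff h S|) where
  const_le c hc := by
    simpa [cubeFourierCoeff_const, apply_ite abs] using hc
  branch_le h i := by
    simp only [sum_eq_sum_powerset_erase i]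
    rw [← Finset.sum_add_distrib]
    refine Finset.sum_le_sum fun S hS => ?_
    have hi : i ∉ S := fun h' => by simpa using Finset.mem_powerset.1 hS h'
    rw [cubeFourierCoeff_update h false hi, cubeFourierCoeff_update h true hi]
    simp only [bitSign, if_true, Bool.false_eq_true, if_false]
    set a := cubeFourierCoeff h S
    set b := cubeFourierCoeff h (insert i S)
    have h1 : |a| + |b| ≤ |a + -1 * b| + |a + 1 * b| := by
      cases abs_cases a <;> cases abs_cases b <;> cases abs_cases (a + -1 * b) <;>
        cases abs_cases (a + 1 * b) <;> linarith
    linarith [abs_nonneg (cubeFourierCoeff (fun x => h (Function.update x i false)) (insert i S)),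
      abs_nonneg (cubeFourierCoeff (fun x => h (Function.update x i true)) (insert i S))]

/-- Pairing `S` with `insert i S`, this is `a² + 2b² ≤ (a - b)² + (a + b)²`; base `2` is the largest
this inequality allows. -/
theorem isLeafBounded_sum_two_pow :
    IsLeafBounded (n := n) (fun h => ∑ S, 2 ^ S.card * cubeFourierCoeff h S ^ 2) where
  const_le c hc := by
    simpa [cubeFourierCoeff_const, ite_pow] using hc
  branch_le h i := by
    simp only [sum_eq_sum_powerset_erase i]
    rw [← Finset.sum_add_distrib]
    refine Finset.sum_le_sum fun S hS => ?_
    have hi : i ∉ S := fun h' => by simpa using Finset.mem_powerset.1 hS h'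
    rw [cubeFourierCoeff_update h false hi, cubeFourierCoeff_update h true hi,
      Finset.card_insert_of_notMem hi, pow_succ (2 : ℝ) S.card]
    simp only [bitSign, if_true, Bool.false_eq_true, if_false]
    have h2 : (0 : ℝ) ≤ 2 ^ S.card := by positivity
    nlinarith [mul_nonneg h2 (sq_nonneg (cubeFourierCoeff h S)), mul_nonneg h2 (sq_nonneg
      (cubeFourierCoeff (fun x => h (Function.update x i false)) (insert i S))),
      mul_nonneg h2 (sq_nonneg
        (cubeFourierCoeff (fun x => h (Function.update x i true)) (insert i S)))]

/-- The contribution of one coordinate to the Fourier coefficients of a restricted character;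
`u` and `s` tell whether the coordinate belongs to the character and to the frequency. -/
noncomputable def coordCoeff : Option Bool → Bool → Bool → ℝ
  | none, u, s => if u = s then 1 else 0
  | some b, u, s => if s then 0 else if u then bitSign b else 1

theorem cubeFourierCoeff_cubeChar_overwrite (ρ : Fin n → Option Bool) (U S : Finset (Fin n)) :
    cubeFourierCoeff (fun x => cubeChar U (overwrite ρ x)) S
      = ∏ i, coordCoeff (ρ i) (decide (i ∈ U)) (decide (i ∈ S)) := by
  have : ∀ x : Fin n → Bool, cubeChar U (overwrite ρ x) * cubeChar S x
      = ∏ i, ((if i ∈ U then bitSign ((ρ i).getD (x i)) else 1)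
        * (if i ∈ S then bitSign (x i) else 1)) := by
    intro x
    rw [cubeChar_eq_prod_ite, cubeChar_eq_prod_ite, ← Finset.prod_mul_distrib]
    rfl
  simp only [cubeFourierCoeff, this]
  rw [expect_eq_prodMean, prodMean_prod (fun i b =>
    (if i ∈ U then bitSign ((ρ i).getD b) else 1) * (if i ∈ S then bitSign b else 1))]
  refine Finset.prod_congr rfl fun i _ => ?_
  rcases ρ i with _ | b <;> by_cases hU : i ∈ U <;> by_cases hS : i ∈ S <;>
    simp [hU, hS, coordCoeff, bitSign]
  norm_num

theorem cubeFourierCoeff_overwrite (F : (Fin n → Bool) → ℝ) (ρ : Fin n → Option Bool)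
    (S : Finset (Fin n)) :
    cubeFourierCoeff (fun x => F (overwrite ρ x)) S
      = ∑ U, cubeFourierCoeff F U *
        ∏ i, coordCoeff (ρ i) (decide (i ∈ U)) (decide (i ∈ S)) := by
  have : (fun x => F (overwrite ρ x))
      = fun x => ∑ U, cubeFourierCoeff F U * cubeChar U (overwrite ρ x) :=
    funext fun x => eq_sum_cubeFourierCoeff F _
  rw [this, cubeFourierCoeff_sum]
  refine Finset.sum_congr rfl fun U _ => ?_
  rw [cubeFourierCoeff_const_mul, cubeFourierCoeff_cubeChar_overwrite]

theorem prod_ite_decide_mem_eq (U V : Finset (Fin n)) (c : ℝ) :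
    ∏ i, (if decide (i ∈ U) = decide (i ∈ V) then (if i ∈ U then c else 1) else 0)
      = if U = V then c ^ U.card else 0 := by
  split_ifs with h
  · subst h
    simp
  · obtain ⟨i, hi⟩ : ∃ i, ¬(i ∈ U ↔ i ∈ V) := by
      by_contra! hc; exact h (Finset.ext hc)
    refine Finset.prod_eq_zero (Finset.mem_univ i) (if_neg fun h => hi ?_)
    simpa using h

/-- Only `U = S` survives: a fixed coordinate of `U` contributes a sign of mean zero, and each
coordinate of `S` must stay free. -/
theorem prodMean_cubeFourierCoeff_overwrite (p : ℝ) (F : (Fin n → Bool) → ℝ)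
    (S : Finset (Fin n)) :
    prodMean (starWeight p) (fun ρ => cubeFourierCoeff (fun x => F (overwrite ρ x)) S)
      = p ^ S.card * cubeFourierCoeff F S := by
  simp only [cubeFourierCoeff_overwrite]
  rw [prodMean_sum]
  have : ∀ U, prodMean (starWeight p) (fun ρ => cubeFourierCoeff F U *
        ∏ i, coordCoeff (ρ i) (decide (i ∈ U)) (decide (i ∈ S)))
      = if U = S then p ^ S.card * cubeFourierCoeff F S else 0 := by
    intro U
    rw [prodMean_const_mul, prodMean_prod (fun i v =>
      coordCoeff v (decide (i ∈ U)) (decide (i ∈ S)))]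
    have h : ∀ i, ∑ v, starWeight p v * coordCoeff v (decide (i ∈ U)) (decide (i ∈ S))
        = if decide (i ∈ U) = decide (i ∈ S) then (if i ∈ U then p else 1) else 0 := by
      intro i
      by_cases hU : i ∈ U <;> by_cases hS : i ∈ S <;>
        simp [hU, hS, Fintype.sum_option, starWeight, coordCoeff, bitSign]
      ring
    simp only [h]
    rw [prod_ite_decide_mem_eq]
    split_ifs with hUS
    · subst hUS; ring
    · ring
  simp [this]

/-- Cross terms `U ≠ V` average to zero. A coordinate of `U` contributes `2` if free and `1` if
fixed, with mean `2p + (1 - p) = 1 + p`. -/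
theorem prodMean_sum_two_pow_overwrite (p : ℝ) (F : (Fin n → Bool) → ℝ) :
    prodMean (starWeight p)
        (fun ρ => ∑ S, 2 ^ S.card * cubeFourierCoeff (fun x => F (overwrite ρ x)) S ^ 2)
      = ∑ S, (1 + p) ^ S.card * cubeFourierCoeff F S ^ 2 := by
  have hprod : ∀ (ρ : Fin n → Option Bool) (U V : Finset (Fin n)),
      ∑ S : Finset (Fin n), 2 ^ S.card *
        ((∏ i, coordCoeff (ρ i) (decide (i ∈ U)) (decide (i ∈ S))) *
          ∏ i, coordCoeff (ρ i) (decide (i ∈ V)) (decide (i ∈ S)))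
      = ∏ i, (2 * (coordCoeff (ρ i) (decide (i ∈ U)) true * coordCoeff (ρ i) (decide (i ∈ V)) true)
        + coordCoeff (ρ i) (decide (i ∈ U)) false * coordCoeff (ρ i) (decide (i ∈ V)) false) := by
    intro ρ U V
    rw [← sum_prod_ite_mem]
    refine Finset.sum_congr rfl fun S _ => ?_
    have h2 : (2 : ℝ) ^ S.card = ∏ i, if i ∈ S then 2 else 1 := by
      simp
    rw [h2, ← Finset.prod_mul_distrib, ← Finset.prod_mul_distrib]
    refine Finset.prod_congr rfl fun i _ => ?_
    by_cases hS : i ∈ S <;> simp [hS]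
  have hsq : ∀ ρ : Fin n → Option Bool,
      ∑ S, 2 ^ S.card * cubeFourierCoeff (fun x => F (overwrite ρ x)) S ^ 2
      = ∑ U, ∑ V, (cubeFourierCoeff F U * cubeFourierCoeff F V) *
        ∏ i, (2 * (coordCoeff (ρ i) (decide (i ∈ U)) true *
            coordCoeff (ρ i) (decide (i ∈ V)) true)
          + coordCoeff (ρ i) (decide (i ∈ U)) false *
            coordCoeff (ρ i) (decide (i ∈ V)) false) := by
    intro ρ
    simp only [← hprod, cubeFourierCoeff_overwrite, sq, Finset.sum_mul_sum]
    simp only [Finset.mul_sum]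
    rw [Finset.sum_comm]
    refine Finset.sum_congr rfl fun U _ => ?_
    rw [Finset.sum_comm]
    exact Finset.sum_congr rfl fun V _ => Finset.sum_congr rfl fun S _ => by ring
  simp only [hsq]
  rw [prodMean_sum]
  refine Finset.sum_congr rfl fun U _ => ?_
  rw [prodMean_sum]
  have : ∀ V, prodMean (starWeight p) (fun ρ => (cubeFourierCoeff F U * cubeFourierCoeff F V) *
        ∏ i, (2 * (coordCoeff (ρ i) (decide (i ∈ U)) true *
            coordCoeff (ρ i) (decide (i ∈ V)) true)
          + coordCoeff (ρ i) (decide (i ∈ U)) false *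
            coordCoeff (ρ i) (decide (i ∈ V)) false))
      = if U = V then (1 + p) ^ U.card * cubeFourierCoeff F U ^ 2 else 0 := by
    intro V
    rw [prodMean_const_mul, prodMean_prod (fun i v =>
      2 * (coordCoeff v (decide (i ∈ U)) true * coordCoeff v (decide (i ∈ V)) true)
        + coordCoeff v (decide (i ∈ U)) false * coordCoeff v (decide (i ∈ V)) false)]
    have h : ∀ i, ∑ v, starWeight p v *
          (2 * (coordCoeff v (decide (i ∈ U)) true * coordCoeff v (decide (i ∈ V)) true)
            + coordCoeff v (decide (i ∈ U)) false * coordCoeff v (decide (i ∈ V)) false)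
        = if decide (i ∈ U) = decide (i ∈ V) then (if i ∈ U then 1 + p else 1) else 0 := by
      intro i
      by_cases hU : i ∈ U <;> by_cases hV : i ∈ V <;>
        simp [hU, hV, Fintype.sum_option, starWeight, coordCoeff, bitSign] <;> ring
    simp only [h]
    rw [prod_ite_decide_mem_eq]
    split_ifs with hUV
    · subst hUV; ring
    · ring
  simp [this]

theorem IsDecisionList.prodMean_overwrite_le {p : ℝ} (h0 : 0 ≤ p) (h1 : p ≤ 1)
    (hk : ∀ w ≤ k, 2 * (2 * p + (1 - p) / 2) ^ w ≤ 3 * ((1 - p) / 2) ^ w)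
    {L : ((Fin n → Bool) → ℝ) → ℝ} (hL : IsLeafBounded L)
    {f : (Fin n → Bool) → ℝ} (hf : IsDecisionList k f) :
    prodMean (starWeight p) (fun ρ => L (fun x => f (overwrite ρ x))) ≤ 2 := by
  have := hf.eventMean_restrict_le h0 h1 hk hL (fun _ => none) (D := fun _ => True)
    (fun _ _ _ h => h)
  have hnone : ∀ y : Fin n → Bool, overwrite (fun _ => none) y = y := fun _ => rfl
  simpa [eventMean, hnone, prodMean_one (sum_starWeight p)] using this

theorem IsDecisionList.sum_pow_mul_abs_le {p : ℝ} (h0 : 0 ≤ p) (h1 : p ≤ 1)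
    (hk : ∀ w ≤ k, 2 * (2 * p + (1 - p) / 2) ^ w ≤ 3 * ((1 - p) / 2) ^ w)
    {f : (Fin n → Bool) → ℝ} (hf : IsDecisionList k f) :
    ∑ S, p ^ S.card * |cubeFourierCoeff f S| ≤ 2 := by
  refine le_trans ?_ (hf.prodMean_overwrite_le h0 h1 hk isLeafBounded_sum_abs)
  rw [prodMean_sum]
  refine Finset.sum_le_sum fun S _ => ?_
  refine le_trans (le_of_eq ?_) (abs_prodMean_le (starWeight_nonneg h0 h1) _)
  rw [prodMean_cubeFourierCoeff_overwrite, abs_mul, abs_of_nonneg (pow_nonneg h0 _)]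

theorem IsDecisionList.sum_one_add_pow_mul_sq_le {p : ℝ} (h0 : 0 ≤ p) (h1 : p ≤ 1)
    (hk : ∀ w ≤ k, 2 * (2 * p + (1 - p) / 2) ^ w ≤ 3 * ((1 - p) / 2) ^ w)
    {f : (Fin n → Bool) → ℝ} (hf : IsDecisionList k f) :
    ∑ S, (1 + p) ^ S.card * cubeFourierCoeff f S ^ 2 ≤ 2 := by
  rw [← prodMean_sum_two_pow_overwrite]
  exact hf.prodMean_overwrite_le h0 h1 hk isLeafBounded_sum_two_pow

end FourierFunctionals

/-! ### From pseudo-Boolean DNFs to sparse approximations. -/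

section Approximation

variable {n k : ℕ}

theorem isDecisionList_rescale {r : ℕ} (hr : 1 ≤ r) {f : (Fin n → Bool) → ℕ}
    (hf : f ∈ pbDNF n k r) : IsDecisionList k (rescale r f) := by
  obtain ⟨s, T, hT, hfT⟩ := hf
  have hr' : (1 : ℝ) ≤ r := by exact_mod_cast hr
  have hval : ∀ a : ℕ, a ≤ r → |2 / (r : ℝ) * (a : ℝ) - 1| ≤ 1 := by
    intro a ha
    have ha' : (a : ℝ) ≤ r := by exact_mod_cast ha
    have h1 : (a : ℝ) / r ≤ 1 := div_le_one_of_le₀ ha' (by linarith)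
    have h2 : 0 ≤ (a : ℝ) / r := by positivity
    have h3 : 2 / (r : ℝ) * (a : ℝ) = 2 * ((a : ℝ) / r) := by ring
    rw [h3, abs_le]
    constructor <;> linarith
  have key : ∀ A : Finset (Fin s), IsDecisionList k
      (rescale r fun x => A.sup fun t => (T t).eval x) := by
    intro A
    -- Each new term has the largest constant so far, so it can be tested at the head of the list.
    refine Finset.induction_on_max_value (fun t => (T t).const) A ?_ ?_
    · convert IsDecisionList.const (n := n) (k := k) (-1) (by simp) using 1
      funext x
      simp [rescale]
    · intro t A ht hmax ih
      -- A term containing a variable and its negation is identically zero and is dropped.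
      by_cases hd : ∃ i, i ∈ (T t).pos ∧ i ∈ (T t).neg
      · obtain ⟨i, hi1, hi2⟩ := hd
        have : ∀ x, (T t).eval x = 0 := by
          intro x
          refine if_neg fun h => ?_
          have h1 := h.1 i hi1
          rw [h.2 i hi2] at h1
          cases h1
        simpa [Finset.sup_insert, this] using ih
      · push Not at hd
        have hsat : ∀ x : Fin n → Bool, (T t).Satisfied x ↔
            ∀ i ∈ (T t).pos ∪ (T t).neg, x i = decide (i ∈ (T t).pos) := by
          intro x
          constructor
          · rintro ⟨h1, h2⟩ i hi
            by_cases hp : i ∈ (T t).pos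
            · simp [hp, h1 i hp]
            · simp [hp, h2 i ((Finset.mem_union.1 hi).resolve_left hp)]
          · intro h
            constructor
            · intro i hi
              simpa [hi] using h i (Finset.mem_union_left _ hi)
            · intro i hi
              have hp : i ∉ (T t).pos := fun hp => hd i hp hi
              simpa [hp] using h i (Finset.mem_union_right _ hi)
        have hstep := IsDecisionList.ite ((T t).pos ∪ (T t).neg)
          (fun i => decide (i ∈ (T t).pos)) (2 / (r : ℝ) * ((T t).const : ℝ) - 1) _
          ((Finset.card_union_le _ _).trans (hT t).1) (hval _ (hT t).2) ih
        convert hstep using 1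
        funext x
        simp only [← hsat]
        by_cases hx : (T t).Satisfied x
        · have hle : (A.sup fun t => (T t).eval x) ≤ (T t).const := by
            refine Finset.sup_le fun u hu => ?_
            unfold PBTerm.eval
            split_ifs
            exacts [hmax u hu, Nat.zero_le _]
          have he : (T t).eval x = (T t).const := if_pos hx
          simp only [hx, if_true, rescale, Finset.sup_insert, he, sup_eq_left.2 hle]
        · have he : (T t).eval x = 0 := if_neg hx
          simp [hx, rescale, Finset.sup_insert, he]
  have : f = fun x => Finset.univ.sup fun t => (T t).eval x := funext hfT
  rw [this]
  exact key _

theorem IsDecisionList.abs_le_one {f : (Fin n → Bool) → ℝ} (hf : IsDecisionList k f)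
    (x : Fin n → Bool) : |f x| ≤ 1 := by
  induction hf with
  | const c hc => exact hc
  | ite V s c f hV hc hf ih => beta_reduce; split_ifs <;> assumption

theorem IsDecisionList.exists_eq_const {f : (Fin n → Bool) → ℝ} (hf : IsDecisionList 0 f) :
    ∃ c, f = fun _ => c := by
  cases hf with
  | const c hc => exact ⟨c, rfl⟩
  | ite V s c f hV hc hf =>
    have : V = ∅ := Finset.card_eq_zero.1 (Nat.le_zero.1 hV)
    exact ⟨c, by simp [this]⟩

theorem isFourierSparse_const (c : ℝ) : IsFourierSparse (n := n) 1 (fun _ => c) := by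
  unfold IsFourierSparse
  have : {S : Finset (Fin n) | cubeFourierCoeff (fun _ => c) S ≠ 0} ⊆ {∅} := by
    intro S hS
    by_contra h
    exact hS ((cubeFourierCoeff_const c S).trans (if_neg h))
  have := Set.ncard_le_ncard this
  rw [Set.ncard_singleton] at this
  exact_mod_cast this

theorem expect_sq_sub_partial_sum (F : (Fin n → Bool) → ℝ) (A : Finset (Finset (Fin n))) :
    𝔼 x, (F x - ∑ S ∈ A, cubeFourierCoeff F S * cubeChar S x) ^ 2
      = ∑ S ∈ Aᶜ, cubeFourierCoeff F S ^ 2 := by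
  have : ∀ x, F x - ∑ S ∈ A, cubeFourierCoeff F S * cubeChar S x
      = ∑ S ∈ Aᶜ, cubeFourierCoeff F S * cubeChar S x := by
    intro x
    rw [eq_sum_cubeFourierCoeff F x, ← Finset.sum_add_sum_compl A]
    ring
  simp only [this]
  rw [expect_sq_eq_sum_cubeFourierCoeff_sq]
  rw [← Finset.sum_subset (Finset.subset_univ Aᶜ)]
  · exact Finset.sum_congr rfl fun S hS => by rw [cubeFourierCoeff_sum_cubeChar, if_pos hS]
  · intro S _ hS
    rw [cubeFourierCoeff_sum_cubeChar, if_neg hS, sq, zero_mul]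

/-- A function whose Fourier spectrum decays geometrically in mean square and has geometrically
growing level sums is approximated by its large low-degree Fourier coefficients. -/
theorem exists_sparse_approximation {F : (Fin n → Bool) → ℝ} {p ε : ℝ} (h0 : 0 < p) (h1 : p ≤ 1)
    (hε : 0 < ε) (habs : ∑ S, p ^ S.card * |cubeFourierCoeff F S| ≤ 2)
    (hsq : ∑ S, (1 + p) ^ S.card * cubeFourierCoeff F S ^ 2 ≤ 2)
    {d : ℕ} (hd : 4 ≤ ε * (1 + p) ^ d) :
    ∃ g : (Fin n → Bool) → ℝ, IsFourierSparse (8 / (ε * p ^ (2 * d))) g ∧ Approximates ε g F := by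
  -- With this threshold a discarded coefficient of degree at most `d` satisfies `c² ≤ θ|c| ≤ (ε/4)
  -- p^|S| |c|`. Low and high degrees then each contribute at most `ε/2` to the error.
  set θ := ε * p ^ d / 4 with hθ
  have hpd : 0 < p ^ d := pow_pos h0 d
  have hθ0 : 0 < θ := by positivity
  set A : Finset (Finset (Fin n)) :=
    Finset.univ.filter fun S => S.card ≤ d ∧ θ ≤ |cubeFourierCoeff F S| with hA
  refine ⟨fun x => ∑ S ∈ A, cubeFourierCoeff F S * cubeChar S x, ?_, ?_⟩
  · have hsub : {S | cubeFourierCoeff (fun x => ∑ S ∈ A, cubeFourierCoeff F S * cubeChar S x) S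
        ≠ 0} ⊆ (A : Set (Finset (Fin n))) := by
      intro S hS
      by_contra h
      exact hS (by rw [cubeFourierCoeff_sum_cubeChar, if_neg (by simpa using h)])
    have hcard := Set.ncard_le_ncard hsub
    rw [Set.ncard_coe_finset] at hcard
    have hcard' : (A.card : ℝ) * (p ^ d * θ) ≤ 2 := by
      refine le_trans ?_ habs
      refine le_trans ?_ (Finset.sum_le_sum_of_subset_of_nonneg (Finset.subset_univ A)
        fun S _ _ => by positivity)
      rw [← nsmul_eq_mul]
      refine Finset.card_nsmul_le_sum _ _ _ fun S hS => ?_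
      obtain ⟨-, h2, h3⟩ := Finset.mem_filter.1 hS
      exact mul_le_mul (pow_le_pow_of_le_one h0.le h1 h2) h3 hθ0.le (by positivity)
    unfold IsFourierSparse
    refine (Nat.cast_le.2 hcard).trans ?_
    rw [le_div_iff₀ (by positivity), two_mul, pow_add]
    have : (A.card : ℝ) * (ε * (p ^ d * p ^ d)) = 4 * (A.card * (p ^ d * θ)) := by
      rw [hθ]; ring
    linarith
  · unfold Approximates
    rw [expect_sq_sub_partial_sum]
    have hterm : ∀ S ∈ Aᶜ, cubeFourierCoeff F S ^ 2 ≤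
        ε / 4 * ((1 + p) ^ S.card * cubeFourierCoeff F S ^ 2)
          + ε / 4 * (p ^ S.card * |cubeFourierCoeff F S|) := by
      intro S hS
      have hS' : S.card ≤ d → |cubeFourierCoeff F S| < θ := by
        intro h
        by_contra! h'
        exact Finset.mem_compl.1 hS (by simp [hA, h, h'])
      have hc2 := sq_nonneg (cubeFourierCoeff F S)
      have hc1 := abs_nonneg (cubeFourierCoeff F S)
      rcases le_or_gt S.card d with h | h
      · have e1 : cubeFourierCoeff F S ^ 2 ≤ θ * |cubeFourierCoeff F S| := by
          rw [← sq_abs, sq]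
          exact mul_le_mul_of_nonneg_right (hS' h).le hc1
        have e2 : θ * |cubeFourierCoeff F S| ≤ ε / 4 * (p ^ S.card * |cubeFourierCoeff F S|) := by
          have := mul_le_mul_of_nonneg_right (pow_le_pow_of_le_one h0.le h1 h) hc1
          have := mul_le_mul_of_nonneg_left this (by positivity : 0 ≤ ε / 4)
          rw [hθ]; linarith
        have e3 : 0 ≤ ε / 4 * ((1 + p) ^ S.card * cubeFourierCoeff F S ^ 2) := by positivity
        linarith
      · have e1 : 1 ≤ ε / 4 * (1 + p) ^ S.card := by
          have := mul_le_mul_of_nonneg_left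
            (pow_le_pow_right₀ (by linarith : (1 : ℝ) ≤ 1 + p) h.le) hε.le
          linarith
        have e2 := mul_le_mul_of_nonneg_right e1 hc2
        have e3 : 0 ≤ ε / 4 * (p ^ S.card * |cubeFourierCoeff F S|) := by positivity
        linarith
    refine (Finset.sum_le_sum hterm).trans ?_
    rw [Finset.sum_add_distrib, ← Finset.mul_sum, ← Finset.mul_sum]
    have s1 := Finset.sum_le_sum_of_subset_of_nonneg (Finset.subset_univ Aᶜ)
      (f := fun S => (1 + p) ^ S.card * cubeFourierCoeff F S ^ 2) fun S _ _ => by positivity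
    have s2 := Finset.sum_le_sum_of_subset_of_nonneg (Finset.subset_univ Aᶜ)
      (f := fun S => p ^ S.card * |cubeFourierCoeff F S|) fun S _ _ => by positivity
    have t1 := mul_le_mul_of_nonneg_left (s1.trans hsq) (by positivity : 0 ≤ ε / 4)
    have t2 := mul_le_mul_of_nonneg_left (s2.trans habs) (by positivity : 0 ≤ ε / 4)
    linarith

/-- Since `b ≥ 1/2`, the ratio satisfies `(a/b)^w ≥ 1 - 4pk = 4/5`, more than the required `2/3`. -/
theorem star_probability_bound {k w : ℕ} (hk : 1 ≤ k) (hw : w ≤ k) :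
    2 * (2 * (1 / (20 * (k : ℝ))) + (1 - 1 / (20 * (k : ℝ))) / 2) ^ w
      ≤ 3 * ((1 - 1 / (20 * (k : ℝ))) / 2) ^ w := by
  have hk' : (1 : ℝ) ≤ k := by exact_mod_cast hk
  set p := 1 / (20 * (k : ℝ)) with hp
  have hpk : p * k = 1 / 20 := by rw [hp]; field_simp
  have hp0 : 0 < p := by positivity
  have hp1 : p ≤ 1 / 20 := by nlinarith
  set a := (1 - p) / 2 with ha
  set b := 2 * p + a with hb
  have ha0 : 0 < a := by rw [ha]; linarith
  have hb0 : 0 < b := by linarith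
  have hwk : (w : ℝ) ≤ k := by exact_mod_cast hw
  -- Bernoulli's inequality for `a / b = 1 - 2 p / b`
  have hbern := one_add_mul_le_pow (a := -(2 * p / b)) (by
    have : 2 * p / b ≤ 1 := by rw [div_le_one hb0]; linarith
    linarith) w
  have hab : 1 + -(2 * p / b) = a / b := by
    rw [hb]; field_simp; ring
  have h3 : 2 / 3 ≤ (a / b) ^ w := by
    rw [← hab]
    refine le_trans ?_ hbern
    have : 2 * p / b ≤ 4 * p := by
      rw [div_le_iff₀ hb0]
      nlinarith
    have h4 : (w : ℝ) * (2 * p / b) ≤ k * (4 * p) :=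
      mul_le_mul hwk this (by positivity) (by positivity)
    nlinarith
  rw [div_pow, le_div_iff₀ (pow_pos hb0 w)] at h3
  linarith

theorem sparsity_bound {k r : ℕ} (hk : 1 ≤ k) {ε : ℝ} (hε : 0 < ε) (hε1 : ε < 1) :
    ∃ d : ℕ, 4 ≤ ε * (1 + 1 / (20 * (k : ℝ))) ^ d ∧
      8 / (ε * (1 / (20 * (k : ℝ))) ^ (2 * d))
        ≤ (max (k : ℝ) 2) ^ (1000 * (k : ℝ) * Real.log (max (r : ℝ) 2 / ε)) := by
  have hk' : (1 : ℝ) ≤ k := by exact_mod_cast hk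
  set K := max (k : ℝ) 2 with hK
  set l := Real.log (max (r : ℝ) 2 / ε) with hl
  have hK2 : 2 ≤ K := le_max_right _ _
  have hkK : (k : ℝ) ≤ K := le_max_left _ _
  have hlog2 : 1 / 2 < Real.log 2 := by linarith [Real.log_two_gt_d9]
  have hl2 : Real.log 2 - Real.log ε ≤ l := by
    rw [← Real.log_div (by norm_num) hε.ne', hl]
    exact Real.log_le_log (by positivity)
      (div_le_div_of_nonneg_right (le_max_right _ _) hε.le)
  have hle : Real.log ε < 0 := Real.log_neg hε hε1
  have hlK : 1 / 2 < Real.log K :=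
    hlog2.trans_le (Real.log_le_log (by norm_num) hK2)
  have hl0 : 1 / 2 < l := by linarith
  have h4 : Real.log 4 = 2 * Real.log 2 := by
    rw [show (4 : ℝ) = 2 ^ 2 by norm_num, Real.log_pow]; norm_num
  have h8 : Real.log 8 = 3 * Real.log 2 := by
    rw [show (8 : ℝ) = 2 ^ 3 by norm_num, Real.log_pow]; norm_num
  have h20 : Real.log (20 * (k : ℝ)) ≤ 6 * Real.log K := by
    have : 20 * (k : ℝ) ≤ K ^ 6 := by
      have h5 : (2 : ℝ) ^ 5 ≤ K ^ 5 := pow_le_pow_left₀ (by norm_num) hK2 5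
      calc 20 * (k : ℝ) ≤ K ^ 5 * K := mul_le_mul (by linarith) hkK (by linarith) (by positivity)
        _ = K ^ 6 := by ring
    have h := Real.log_le_log (by positivity) this
    rw [Real.log_pow] at h
    exact_mod_cast h
  have h20' : 0 ≤ Real.log (20 * (k : ℝ)) := Real.log_nonneg (by linarith)
  have hkl : 1 / 2 ≤ k * l := by nlinarith
  -- As `log (1 + p) ≥ p/2 = 1/(40k)`, this degree gives `(1 + p)^d ≥ e^(2l) ≥ (2/ε)² ≥ 4/ε`.
  refine ⟨⌈80 * (k : ℝ) * l⌉₊, ?_, ?_⟩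
  · have hd : 80 * (k : ℝ) * l ≤ (⌈80 * (k : ℝ) * l⌉₊ : ℕ) := Nat.le_ceil _
    set d := ⌈80 * (k : ℝ) * l⌉₊
    set p := 1 / (20 * (k : ℝ)) with hp
    have hpk : p * k = 1 / 20 := by rw [hp]; field_simp
    have hp0 : 0 < p := by positivity
    have hp1 : p ≤ 1 := by nlinarith
    have hlogp : p / 2 ≤ Real.log (1 + p) := by
      have h := Real.one_sub_inv_le_log_of_pos (by linarith : 0 < 1 + p)
      have : p / 2 ≤ 1 - (1 + p)⁻¹ := by
        rw [show 1 - (1 + p)⁻¹ = p / (1 + p) by field_simp; ring]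
        exact div_le_div_of_nonneg_left hp0.le (by linarith) (by linarith)
      linarith
    rw [← Real.log_le_log_iff (by norm_num) (by positivity), Real.log_mul hε.ne' (by positivity),
      Real.log_pow, h4]
    have e1 : 80 * (k : ℝ) * l * (p / 2) ≤ d * Real.log (1 + p) :=
      mul_le_mul hd hlogp (by positivity) (by positivity)
    have e2 : 80 * (k : ℝ) * l * (p / 2) = 2 * l := by
      linear_combination 40 * l * hpk
    linarith
  · have hd : (⌈80 * (k : ℝ) * l⌉₊ : ℝ) ≤ 80 * (k : ℝ) * l + 1 :=
      (Nat.ceil_lt_add_one (by nlinarith)).le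
    set d := ⌈80 * (k : ℝ) * l⌉₊
    rw [← Real.log_le_log_iff (by positivity) (by positivity), Real.log_rpow (by positivity),
      Real.log_div (by norm_num) (by positivity), Real.log_mul hε.ne' (by positivity),
      Real.log_pow, one_div, Real.log_inv, h8]
    push_cast
    -- The bound `kl ≥ 1/2` absorbs the rounding: `80kl + 1 ≤ 82kl`. Then `2·82·6 = 984`, and the
    -- remaining `16 kl log K` covers `log 8 - log ε ≤ 3l`.
    have e1 : (d : ℝ) * Real.log (20 * (k : ℝ)) ≤ (82 * (k * l)) * (6 * Real.log K) :=
      mul_le_mul (by linarith) h20 h20' (by positivity)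
    have e2 : 0 ≤ (k * l) * (Real.log K - 1 / 2) := mul_nonneg (by linarith) (by linarith)
    have e3 : 0 ≤ (k - 1) * l := mul_nonneg (by linarith) (by linarith)
    nlinarith

end Approximation

theorem mainTheorem3 :
    ∃ C : ℝ, 0 < C ∧
      ∀ (n k r : ℕ), 1 ≤ r → ∀ f ∈ pbDNF n k r, ∀ ε : ℝ, 0 < ε →
        ∃ g : (Fin n → Bool) → ℝ,
          IsFourierSparse
            ((max (k : ℝ) 2) ^ (C * (k : ℝ) * Real.log (max (r : ℝ) 2 / ε))) g ∧
          Approximates ε g (rescale r f) := by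
  refine ⟨1000, by norm_num, fun n k r hr f hf ε hε => ?_⟩
  have hF := isDecisionList_rescale hr hf
  rcases Nat.eq_zero_or_pos k with rfl | hk
  · obtain ⟨c, hc⟩ := hF.exists_eq_const
    rw [hc]
    refine ⟨fun _ => c, by simpa using isFourierSparse_const c, ?_⟩
    simpa [Approximates] using hε.le
  -- For `ε ≥ 1` the exponent may be negative, so the approximant must have no non-zero coefficient
  -- at all: take `g = 0`.
  rcases le_or_gt 1 ε with h1 | h1
  · refine ⟨fun _ => 0, ?_, ?_⟩
    · simp only [IsFourierSparse, cubeFourierCoeff_const, ite_self, ne_eq, not_true_eq_false,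
        Set.ofPred_false, Set.ncard_empty, Nat.cast_zero]
      positivity
    · unfold Approximates
      refine le_trans (Finset.expect_le Finset.univ_nonempty fun x _ => ?_) h1
      rw [sub_zero, sq_le_one_iff_abs_le_one]
      exact hF.abs_le_one x
  · obtain ⟨d, hd, hbound⟩ := sparsity_bound (r := r) hk hε h1
    have hk' : (1 : ℝ) ≤ k := by exact_mod_cast hk
    have hp0 : 0 < 1 / (20 * (k : ℝ)) := by positivity
    have hp1 : 1 / (20 * (k : ℝ)) ≤ 1 := by
      rw [div_le_one (by positivity)]; linarith
    have hw : ∀ w ≤ k, _ := fun w hw => star_probability_bound hk hw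
    obtain ⟨g, hg, happ⟩ := exists_sparse_approximation hp0 hp1 hε
      (hF.sum_pow_mul_abs_le hp0.le hp1 hw) (hF.sum_one_add_pow_mul_sq_le hp0.le hp1 hw) hd
    exact ⟨g, le_trans hg hbound, happ⟩
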